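/- **Setting.** Let $\mathcal C$ be a bicategory (its associators are suppressed below; they are inserted in the only possible way) and let $W$ be a class of $1$-morphisms of $\mathcal C$ admitting a right bicalculus of fractions, i.e.: * (BF1) $W$ contains all identities; (BF2) $W$ is closed under composition; (BF5) if $w\in W$ and there is an invertible $v\Rightarrow w$, then $v\in W$; * (BF3) for $w:A\to B$ in $W$ and $f:C\to B$ there are $w':D\to C$ in $W$, $f':D\to A$ and an invertible $f\circ w'\Rightarrow w\circ f'$; * (BF4) for $w:B\to A$ in $W$, $f^1,f^2:C\to B$ and $\alpha:w\circ f^1\Rightarrow w\circ f^2$ there are $v:D\to C$ in $W$ and $\beta:f^1\circ v\Rightarrow f^2\circ v$ with $\alpha\circ v=w\circ\beta$, with $\beta$ invertible if $\alpha$ is; and for any two triples $(D,v,\beta)$, $(D',v',\beta')$ with $v,v'\in W$, $\alpha\circ v=w\circ\beta$ and $\alpha\circ v'=w\circ\beta'$ there are $s:E\to D$, $s':E\to D'$ and an invertible $\zeta:v\circ s\Rightarrow v'\circ s'$ such that $v\circ s\in W$ and $(\beta'\circ s')\cdot(f^1\circ\zeta)=(f^2\circ\zeta)\cdot(\beta\circ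 s)$. Fix choices $C(W)$: for each $f:A'\to B$ and each $v:B'\to B$ in $W$, data $(A'',v',f',\rho)$ with $v':A''\to A'$ in $W$, $f':A''\to B'$ and $\rho:f\circ v'\Rightarrow v\circ f'$ invertible. Choices $D(W)$ consist of a pair $(v,\beta)$ as in the first half of (BF4) for each $(w,f^1,f^2,\alpha)$ as there. A $1$-morphism $A\to B$ of $\mathcal C[W^{-1}]$ is a triple $(A',w,f)$ with $w:A'\to A$ in $W$ and $f:A'\to B$. The composite of $(A',w,f):A\to B$ and $(B',v,g):B\to C$ is $(A'',w\circ v',g\circ f')$, with $(A'',v',f',\rho)$ the choice in $C(W)$ for $(f,v)$. A $2$-morphism $(A^1,w^1,f^1)\Rightarrow(A^2,w^2,f^2)$ is an equivalence class of diagrams $(A^3,v^1,v^2,\alpha,\beta)$ with $v^m:A^3\to A^m$, $w^1\circ v^1\in W$, $\alpha:w^1\circ v^1\Rightarrow w^2\circ v^2$ invertible and $\beta:f^1\circ v^1\Rightarrow f^2\circ v^2$. Such a diagram is equivalent to $(A'^3,v'^1,v'^2,\alpha',\beta')$ if there are $z:E\to A^3$, $z':E\to A'^3$ and invertible $\sigma^1:v'^1\circ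 z'\Rightarrow v^1\circ z$, $\sigma^2:v^2\circ z\Rightarrow v'^2\circ z'$ such that $w^1\circ v^1\circ z\in W$, $\alpha'\circ z'=(w^2\circ\sigma^2)\cdot(\alpha\circ z)\cdot(w^1\circ\sigma^1)$ and $\beta'\circ z'=(f^2\circ\sigma^2)\cdot(\beta\circ z)\cdot(f^1\circ\sigma^1)$. **Data.** Let $\underline f=(A',u,f):A\to B$, $\underline g=(B',v,g):B\to C$, $\underline h=(C',w,h):C\to D$ be $1$-morphisms of $\mathcal C[W^{-1}]$. Let $C(W)$ choose, for the pairs $(f,v)$, $(g\circ f^1,w)$, $(g,w)$, $(f,v\circ v^1)$ respectively, $$\delta:f\circ u^1\Rightarrow v\circ f^1,\quad \sigma:g\circ f^1\circ u^2\Rightarrow w\circ l,\quad \xi:g\circ v^1\Rightarrow w\circ g^1,\quad \eta:f\circ u^3\Rightarrow v\circ v^1\circ f^2,$$ where $u^1,u^2,v^1,u^3\in W$ have sources $A^1,A^2,B^2,A^3$. Then $\underline h\circ(\underline g\circ\underline f)=(A^2,u\circ u^1\circ u^2,h\circ l)$ and $(\underline h\circ\underline g)\circ\underline f=(A^3,u\circ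 u^3,h\circ g^1\circ f^2)$. Consider data $(A^4,u^4,u^5,\gamma,\omega,\rho)$ such that * (F1) $u^4:A^4\to A^2$ with $u\circ u^1\circ u^2\circ u^4\in W$, $u^5:A^4\to A^3$, and $\gamma:u^1\circ u^2\circ u^4\Rightarrow u^3\circ u^5$ is invertible; * (F2) $\omega:f^1\circ u^2\circ u^4\Rightarrow v^1\circ f^2\circ u^5$ is invertible and $v\circ\omega=(\eta\circ u^5)\cdot(f\circ\gamma)\cdot(\delta^{-1}\circ u^2\circ u^4)$; * (F3) $\rho:l\circ u^4\Rightarrow g^1\circ f^2\circ u^5$ is invertible and $w\circ\rho=(\xi\circ f^2\circ u^5)\cdot(g\circ\omega)\cdot(\sigma^{-1}\circ u^4)$. The associator $\Theta_{\underline h,\underline g,\underline f}:\underline h\circ(\underline g\circ\underline f)\Rightarrow(\underline h\circ\underline g)\circ\underline f$ defined by the choices $C(W)$ and $D(W)$ is the class of $(A^4,u^4,u^5,u\circ\gamma,h\circ\rho)$ for the following data (F1)–(F3): take the choice in $C(W)$ for $(u^1\circ u^2,u^3)$ as first version of $(\gamma,u^4,u^5)$; apply $D(W)$ to $v$ and the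 right-hand side of (F2) to get $\omega$ after restriction along a morphism of $W$; then apply $D(W)$ to $w$ and the right-hand side of (F3) to get $\rho$ after a further restriction along a morphism of $W$. **Proposition.** 1. For all choices $D(W)$ and *any* data satisfying (F1)–(F3), the associator $\Theta_{\underline h,\underline g,\underline f}$ is represented by the diagram $(A^4,u^4,u^5,u\circ\gamma,h\circ\rho)$. 2. Any two sets of data satisfying (F1)–(F3) induce equivalent diagrams $(A^4,u^4,u^5,u\circ\gamma,h\circ\rho)$. 3. Hence $\Theta_{\underline h,\underline g,\underline f}$ does not depend on $D(W)$, nor on any choice in $C(W)$ other than the four giving $\delta,\sigma,\xi,\eta$. -/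

import Mathlib

open CategoryTheory Bicategory

universe w v u

namespace BicatFractions

/-! Mathlib composes in diagrammatic order: `f ≫ g` is `g ∘ f`, `f ◁ α` is `α ∘ f` and `α ▷ g` is
`g ∘ α`.  The operation `⊗≫` is vertical composition of 2-morphisms with the associators of the
ambient bicategory inserted where they are needed. -/

section Axioms

variable {B : Type u} [Bicategory.{w, v} B]

/-- A square filling the cospan `a --f--> b <--v-- b'`: a span `a <--fst-- obj --snd--> b'` with
`fst` in `W` and an invertible 2-morphism `f ∘ fst ⇒ v ∘ snd`. -/
structure Filler (W : MorphismProperty B) {a b b' : B} (f : a ⟶ b) (v : b' ⟶ b) where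
  obj : B
  fst : obj ⟶ a
  snd : obj ⟶ b'
  mem : W fst
  iso : fst ≫ f ≅ snd ≫ v

/-- For `α : w ∘ f ⇒ w ∘ g`, a morphism `arr` in `W` and a 2-morphism `cell : f ∘ arr ⇒ g ∘ arr`
with `w ∘ cell = α ∘ arr`. -/
structure Lift (W : MorphismProperty B) {a b c : B} (w : b ⟶ a) (f g : c ⟶ b)
    (α : f ≫ w ⟶ g ≫ w) where
  obj : B
  arr : obj ⟶ c
  mem : W arr
  cell : arr ≫ f ⟶ arr ≫ g
  comm : cell ▷ w = 𝟙 _ ⊗≫ arr ◁ α ⊗≫ 𝟙 _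

/-- The class `W` admits a right bicalculus of fractions. -/
structure IsBicalculus (W : MorphismProperty B) : Prop where
  id_mem : ∀ a : B, W (𝟙 a)
  comp_mem : ∀ {a b c : B} (f : a ⟶ b) (g : b ⟶ c), W f → W g → W (f ≫ g)
  filler : ∀ {a b b' : B} (f : a ⟶ b) (v : b' ⟶ b), W v → Nonempty (Filler W f v)
  /-- Lifts along `W` exist, and can be taken invertible for invertible 2-morphisms. -/
  lift : ∀ {a b c : B} (w : b ⟶ a) (f g : c ⟶ b) (α : f ≫ w ⟶ g ≫ w), W w →
    ∃ L : Lift W w f g α, IsIso α → IsIso L.cell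
  /-- Any two lifts agree after restriction. -/
  lift_unique : ∀ {a b c : B} (w : b ⟶ a) (f g : c ⟶ b) (α : f ≫ w ⟶ g ≫ w), W w →
    ∀ L L' : Lift W w f g α,
      ∃ (e : B) (s : e ⟶ L.obj) (s' : e ⟶ L'.obj) (ζ : s ≫ L.arr ≅ s' ≫ L'.arr),
        W (s ≫ L.arr) ∧
          ζ.hom ▷ f ⊗≫ s' ◁ L'.cell ⊗≫ 𝟙 ((s' ≫ L'.arr) ≫ g) =
            𝟙 ((s ≫ L.arr) ≫ f) ⊗≫ s ◁ L.cell ⊗≫ ζ.hom ▷ g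
  of_iso : ∀ {a b : B} (f g : a ⟶ b), W f → Nonempty (g ≅ f) → W g

/-- The choices `C(W)`: a square for every cospan whose second leg is in `W`. -/
abbrev ChoiceC (W : MorphismProperty B) :=
  ∀ ⦃a b b' : B⦄ (f : a ⟶ b) (v : b' ⟶ b), W v → Filler W f v

/-- The choices `D(W)`: a lift, invertible whenever `α` is, of every
`α : w ∘ f ⇒ w ∘ g` with `w` in `W`. -/
abbrev ChoiceD (W : MorphismProperty B) :=
  ∀ ⦃a b c : B⦄ (w : b ⟶ a) (f g : c ⟶ b) (α : f ≫ w ⟶ g ≫ w), W w →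
    {L : Lift W w f g α // IsIso α → IsIso L.cell}

end Axioms

section Fractions

variable {B : Type u} [Bicategory.{w, v} B] {W : MorphismProperty B}

/-- The 1-morphisms `a ⟶ b` of `C[W⁻¹]`: triples `(apex, den, num)` with `den : apex ⟶ a` in `W`
and `num : apex ⟶ b`. -/
structure Fraction (W : MorphismProperty B) (a b : B) where
  apex : B
  den : apex ⟶ a
  num : apex ⟶ b
  mem : W den

/-- The composite `G ∘ F` formed with a given square. -/
abbrev Fraction.compAlong (hW : IsBicalculus W) {a b c : B} (F : Fraction W a b)
    (G : Fraction W b c) (s : Filler W F.num G.den) : Fraction W a c where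
  apex := s.obj
  den := s.fst ≫ F.den
  num := s.snd ≫ G.num
  mem := hW.comp_mem _ _ s.mem F.mem

/-- The composite `G ∘ F` in `C[W⁻¹]`, formed with the square chosen by `C(W)`. -/
abbrev Fraction.comp (hW : IsBicalculus W) (C : ChoiceC W) {a b c : B} (F : Fraction W a b)
    (G : Fraction W b c) : Fraction W a c :=
  F.compAlong hW G (C F.num G.den G.mem)

/-- The data `(apex, left, right, α, β)` that represent 2-morphisms `F ⟹ F'` of `C[W⁻¹]`. -/
structure Diagram {a b : B} (F F' : Fraction W a b) where
  apex : B
  left : apex ⟶ F.apex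
  right : apex ⟶ F'.apex
  mem : W (left ≫ F.den)
  α : left ≫ F.den ≅ right ≫ F'.den
  β : left ≫ F.num ⟶ right ≫ F'.num

/-- Equivalence of diagrams. -/
def Diagram.Equivalent {a b : B} {F F' : Fraction W a b} (X Y : Diagram F F') : Prop :=
  ∃ (e : B) (z : e ⟶ X.apex) (z' : e ⟶ Y.apex)
    (σ₁ : z' ≫ Y.left ≅ z ≫ X.left) (σ₂ : z ≫ X.right ≅ z' ≫ Y.right),
    W (z ≫ X.left ≫ F.den) ∧
      𝟙 (z' ≫ Y.left ≫ F.den) ⊗≫ σ₁.hom ▷ F.den ⊗≫ z ◁ X.α.hom ⊗≫ σ₂.hom ▷ F'.den ⊗≫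
          𝟙 (z' ≫ Y.right ≫ F'.den) = z' ◁ Y.α.hom ∧
      𝟙 (z' ≫ Y.left ≫ F.num) ⊗≫ σ₁.hom ▷ F.num ⊗≫ z ◁ X.β ⊗≫ σ₂.hom ▷ F'.num ⊗≫
          𝟙 (z' ≫ Y.right ≫ F'.num) = z' ◁ Y.β

/-- The 2-morphisms `F ⟹ F'` of `C[W⁻¹]`: diagrams modulo equivalence. -/
def TwoMorphism {a b : B} (F F' : Fraction W a b) :=
  Quot (Diagram.Equivalent (F := F) (F' := F'))

/-- The 2-morphism represented by a diagram. -/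
def Diagram.toTwoMorphism {a b : B} {F F' : Fraction W a b} (X : Diagram F F') :
    TwoMorphism F F' :=
  Quot.mk _ X

end Fractions

section Associators

variable {B : Type u} [Bicategory.{w, v} B] {W : MorphismProperty B} {a b c d : B}

/-- The four squares `δ, σ, ξ, η` used to form `h ∘ (g ∘ f)` and `(h ∘ g) ∘ f`. -/
structure Squares (F : Fraction W a b) (G : Fraction W b c) (H : Fraction W c d) where
  δ : Filler W F.num G.den
  σ : Filler W (δ.snd ≫ G.num) H.den
  ξ : Filler W G.num H.den
  η : Filler W F.num (ξ.fst ≫ G.den)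

/-- The four squares provided by the choices `C(W)`. -/
abbrev Squares.ofChoice (hW : IsBicalculus W) (C : ChoiceC W) (F : Fraction W a b)
    (G : Fraction W b c) (H : Fraction W c d) : Squares F G H where
  δ := C F.num G.den G.mem
  σ := C (F.comp hW C G).num H.den H.mem
  ξ := C G.num H.den H.mem
  η := C F.num (G.comp hW C H).den (G.comp hW C H).mem

namespace Squares

variable {F : Fraction W a b} {G : Fraction W b c} {H : Fraction W c d}

/-- `h ∘ (g ∘ f)`. -/
abbrev source (hW : IsBicalculus W) (S : Squares F G H) : Fraction W a d :=
  (F.compAlong hW G S.δ).compAlong hW H S.σ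

/-- `(h ∘ g) ∘ f`. -/
abbrev target (hW : IsBicalculus W) (S : Squares F G H) : Fraction W a d :=
  F.compAlong hW (G.compAlong hW H S.ξ) S.η

/-- The pasting of `δ⁻¹`, `γ` and `η`; the 2-morphism `v ∘ ω` has to be equal to it. -/
def omegaPasting (S : Squares F G H) {x : B} (u₄ : x ⟶ S.σ.obj) (u₅ : x ⟶ S.η.obj)
    (γ : u₄ ≫ S.σ.fst ≫ S.δ.fst ≅ u₅ ≫ S.η.fst) :
    (u₄ ≫ S.σ.fst ≫ S.δ.snd) ≫ G.den ⟶ (u₅ ≫ S.η.snd ≫ S.ξ.fst) ≫ G.den :=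
  𝟙 _ ⊗≫ u₄ ◁ S.σ.fst ◁ S.δ.iso.inv ⊗≫ γ.hom ▷ F.num ⊗≫ u₅ ◁ S.η.iso.hom ⊗≫ 𝟙 _

/-- The pasting of `σ⁻¹`, `ω` and `ξ`; the 2-morphism `w ∘ ρ` has to be equal to it. -/
def rhoPasting (S : Squares F G H) {x : B} (u₄ : x ⟶ S.σ.obj) (u₅ : x ⟶ S.η.obj)
    (ω : u₄ ≫ S.σ.fst ≫ S.δ.snd ≅ u₅ ≫ S.η.snd ≫ S.ξ.fst) :
    (u₄ ≫ S.σ.snd) ≫ H.den ⟶ (u₅ ≫ S.η.snd ≫ S.ξ.snd) ≫ H.den :=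
  𝟙 _ ⊗≫ u₄ ◁ S.σ.iso.inv ⊗≫ ω.hom ▷ G.num ⊗≫ u₅ ◁ S.η.snd ◁ S.ξ.iso.hom ⊗≫ 𝟙 _

/-- The data `(A⁴, u⁴, u⁵, γ, ω, ρ)` from which the associator is computed. -/
structure AssociatorData (S : Squares F G H) where
  apex : B
  u₄ : apex ⟶ S.σ.obj
  u₅ : apex ⟶ S.η.obj
  mem : W (u₄ ≫ S.σ.fst ≫ S.δ.fst ≫ F.den)
  γ : u₄ ≫ S.σ.fst ≫ S.δ.fst ≅ u₅ ≫ S.η.fst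
  ω : u₄ ≫ S.σ.fst ≫ S.δ.snd ≅ u₅ ≫ S.η.snd ≫ S.ξ.fst
  ω_comm : ω.hom ▷ G.den = S.omegaPasting u₄ u₅ γ
  ρ : u₄ ≫ S.σ.snd ≅ u₅ ≫ S.η.snd ≫ S.ξ.snd
  ρ_comm : ρ.hom ▷ H.den = S.rhoPasting u₄ u₅ ω

/-- The diagram `(A⁴, u⁴, u⁵, u ∘ γ, h ∘ ρ)`. -/
def AssociatorData.diagram (hW : IsBicalculus W) {S : Squares F G H} (X : S.AssociatorData) :
    Diagram (S.source hW) (S.target hW) where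
  apex := X.apex
  left := X.u₄
  right := X.u₅
  mem := X.mem
  α := Iso.refl (X.u₄ ≫ S.σ.fst ≫ S.δ.fst ≫ F.den) ≪⊗≫ whiskerRightIso X.γ F.den ≪⊗≫
    Iso.refl (X.u₅ ≫ S.η.fst ≫ F.den)
  β := 𝟙 (X.u₄ ≫ S.σ.snd ≫ H.num) ⊗≫ X.ρ.hom ▷ H.num ⊗≫
    𝟙 (X.u₅ ≫ S.η.snd ≫ S.ξ.snd ≫ H.num)

theorem isIso_omegaPasting (S : Squares F G H) {x : B} (u₄ : x ⟶ S.σ.obj) (u₅ : x ⟶ S.η.obj)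
    (γ : u₄ ≫ S.σ.fst ≫ S.δ.fst ≅ u₅ ≫ S.η.fst) : IsIso (S.omegaPasting u₄ u₅ γ) := by
  unfold omegaPasting bicategoricalComp
  infer_instance

theorem isIso_rhoPasting (S : Squares F G H) {x : B} (u₄ : x ⟶ S.σ.obj) (u₅ : x ⟶ S.η.obj)
    (ω : u₄ ≫ S.σ.fst ≫ S.δ.snd ≅ u₅ ≫ S.η.snd ≫ S.ξ.fst) : IsIso (S.rhoPasting u₄ u₅ ω) := by
  unfold rhoPasting bicategoricalComp
  infer_instance

theorem omegaPasting_whisker (S : Squares F G H) {x y : B} (r : y ⟶ x) (u₄ : x ⟶ S.σ.obj)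
    (u₅ : x ⟶ S.η.obj) (γ : u₄ ≫ S.σ.fst ≫ S.δ.fst ≅ u₅ ≫ S.η.fst) :
    S.omegaPasting (r ≫ u₄) (r ≫ u₅) (α_ _ _ _ ≪≫ whiskerLeftIso r γ ≪≫ (α_ _ _ _).symm) =
      𝟙 _ ⊗≫ r ◁ S.omegaPasting u₄ u₅ γ ⊗≫ 𝟙 _ := by
  simp only [omegaPasting, Iso.trans_hom, whiskerLeftIso_hom, Iso.symm_hom]
  bicategory

theorem rhoPasting_whisker (S : Squares F G H) {x y : B} (r : y ⟶ x) (u₄ : x ⟶ S.σ.obj)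
    (u₅ : x ⟶ S.η.obj) (ω : u₄ ≫ S.σ.fst ≫ S.δ.snd ≅ u₅ ≫ S.η.snd ≫ S.ξ.fst) :
    S.rhoPasting (r ≫ u₄) (r ≫ u₅) (α_ _ _ _ ≪≫ whiskerLeftIso r ω ≪≫ (α_ _ _ _).symm) =
      𝟙 _ ⊗≫ r ◁ S.rhoPasting u₄ u₅ ω ⊗≫ 𝟙 _ := by
  simp only [rhoPasting, Iso.trans_hom, whiskerLeftIso_hom, Iso.symm_hom]
  bicategory

theorem omega_comm_of_lift (S : Squares F G H) {x : B} (u₄ : x ⟶ S.σ.obj) (u₅ : x ⟶ S.η.obj)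
    (γ : u₄ ≫ S.σ.fst ≫ S.δ.fst ≅ u₅ ≫ S.η.fst)
    (L : Lift W G.den _ _ (S.omegaPasting u₄ u₅ γ)) :
    ((α_ _ _ _).hom ≫ L.cell ≫ (α_ _ _ _).inv) ▷ G.den =
      S.omegaPasting (L.arr ≫ u₄) (L.arr ≫ u₅)
        (α_ _ _ _ ≪≫ whiskerLeftIso L.arr γ ≪≫ (α_ _ _ _).symm) := by
  rw [omegaPasting_whisker, comp_whiskerRight, comp_whiskerRight, L.comm]
  bicategory

theorem omega_comm_whisker (S : Squares F G H) {x y : B} (r : y ⟶ x) (u₄ : x ⟶ S.σ.obj)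
    (u₅ : x ⟶ S.η.obj) (γ : u₄ ≫ S.σ.fst ≫ S.δ.fst ≅ u₅ ≫ S.η.fst)
    (ω : u₄ ≫ S.σ.fst ≫ S.δ.snd ≅ u₅ ≫ S.η.snd ≫ S.ξ.fst)
    (h : ω.hom ▷ G.den = S.omegaPasting u₄ u₅ γ) :
    ((α_ _ _ _).hom ≫ r ◁ ω.hom ≫ (α_ _ _ _).inv) ▷ G.den =
      S.omegaPasting (r ≫ u₄) (r ≫ u₅)
        (α_ _ _ _ ≪≫ whiskerLeftIso r γ ≪≫ (α_ _ _ _).symm) := by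
  rw [omegaPasting_whisker, ← h]
  bicategory

theorem rho_comm_of_lift (S : Squares F G H) {x : B} (u₄ : x ⟶ S.σ.obj) (u₅ : x ⟶ S.η.obj)
    (ω : u₄ ≫ S.σ.fst ≫ S.δ.snd ≅ u₅ ≫ S.η.snd ≫ S.ξ.fst)
    (M : Lift W H.den _ _ (S.rhoPasting u₄ u₅ ω)) :
    ((α_ _ _ _).hom ≫ M.cell ≫ (α_ _ _ _).inv) ▷ H.den =
      S.rhoPasting (M.arr ≫ u₄) (M.arr ≫ u₅)
        (α_ _ _ _ ≪≫ whiskerLeftIso M.arr ω ≪≫ (α_ _ _ _).symm) := by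
  rw [rhoPasting_whisker, comp_whiskerRight, comp_whiskerRight, M.comm]
  bicategory

/-- The associator data obtained from a square `s` over `A'` for the cospan formed by `u¹ ∘ u²`
and `u³`, a lift `L` along `v` of the resulting pasting of `δ⁻¹`, `s.iso` and `η`, and a lift `M`
along `w` of the resulting pasting of `σ⁻¹`, `ω` and `ξ`; all data are restricted to `M.obj`. -/
noncomputable def dataOfLifts (hW : IsBicalculus W) (S : Squares F G H)
    (s : Filler W (S.σ.fst ≫ S.δ.fst) S.η.fst)
    (L : Lift W G.den _ _ (S.omegaPasting s.fst s.snd s.iso)) [IsIso L.cell]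
    (M : Lift W H.den _ _ (S.rhoPasting (L.arr ≫ s.fst) (L.arr ≫ s.snd)
      (α_ _ _ _ ≪≫ asIso L.cell ≪≫ (α_ _ _ _).symm))) [IsIso M.cell] :
    S.AssociatorData where
  apex := M.obj
  u₄ := M.arr ≫ L.arr ≫ s.fst
  u₅ := M.arr ≫ L.arr ≫ s.snd
  mem := hW.comp_mem _ _
    (hW.comp_mem _ _ M.mem (hW.comp_mem _ _ L.mem s.mem))
    (hW.comp_mem _ _ S.σ.mem (hW.comp_mem _ _ S.δ.mem F.mem))
  γ := α_ _ _ _ ≪≫ whiskerLeftIso M.arr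
    (α_ _ _ _ ≪≫ whiskerLeftIso L.arr s.iso ≪≫ (α_ _ _ _).symm) ≪≫ (α_ _ _ _).symm
  ω := α_ _ _ _ ≪≫ whiskerLeftIso M.arr
    (α_ _ _ _ ≪≫ asIso L.cell ≪≫ (α_ _ _ _).symm) ≪≫ (α_ _ _ _).symm
  ω_comm := S.omega_comm_whisker M.arr _ _ _ _ (S.omega_comm_of_lift _ _ _ L)
  ρ := α_ _ _ _ ≪≫ asIso M.cell ≪≫ (α_ _ _ _).symm
  ρ_comm := S.rho_comm_of_lift _ _ _ M

/-- The associator data induced by the choices: the square over `A'` is the one in `C(W)`, the two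
lifts are those in `D(W)`. -/
noncomputable def chosenData (hW : IsBicalculus W) (C : ChoiceC W) (D : ChoiceD W)
    (S : Squares F G H) : S.AssociatorData :=
  let s := C (S.σ.fst ≫ S.δ.fst) S.η.fst S.η.mem
  let L := D G.den _ _ (S.omegaPasting s.fst s.snd s.iso) G.mem
  haveI : IsIso L.1.cell := L.2 (S.isIso_omegaPasting _ _ _)
  let M := D H.den _ _ (S.rhoPasting (L.1.arr ≫ s.fst) (L.1.arr ≫ s.snd)
    (α_ _ _ _ ≪≫ asIso L.1.cell ≪≫ (α_ _ _ _).symm)) H.mem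
  haveI : IsIso M.1.cell := M.2 (S.isIso_rhoPasting _ _ _)
  S.dataOfLifts hW s L.1 M.1

/-- The 2-morphism `h ∘ (g ∘ f) ⟹ (h ∘ g) ∘ f` obtained from the choices `C(W)` and `D(W)`, where
the composites are formed with the given squares. -/
noncomputable def associator (hW : IsBicalculus W) (C : ChoiceC W) (D : ChoiceD W)
    (S : Squares F G H) : TwoMorphism (S.source hW) (S.target hW) :=
  ((S.chosenData hW C D).diagram hW).toTwoMorphism

end Squares

/-- The associator of `C[W⁻¹]`, constructed from the choices `C(W)` and `D(W)`. -/
noncomputable def associator (hW : IsBicalculus W) (C : ChoiceC W) (D : ChoiceD W)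
    (F : Fraction W a b) (G : Fraction W b c) (H : Fraction W c d) :
    TwoMorphism ((F.comp hW C G).comp hW C H) (F.comp hW C (G.comp hW C H)) :=
  (Squares.ofChoice hW C F G H).associator hW C D

end Associators

end BicatFractions

/-! The diagrams of two sets of data `X`, `X'` are equivalent once a single pair of identifications
`σ₁`, `σ₂` of their legs, over a common object, makes both the `α`s and the `β`s `Compatible`. As
these are `u ∘ γ` and `h ∘ ρ`, it suffices to treat `γ` and `ρ`. Compatibility survives pasting with
fixed cells (`paste`). It can also be cancelled along a morphism of `W` after restriction
(`exists_of_whiskerRight`), because uniqueness of lifts makes whiskering with such a morphism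
faithful up to restriction. A square over `A`, lifted along `u ∘ u¹ ∘ u²`, gives `σ₁`; since `u³` is
in `W`, a second lift gives `σ₂` making the `γ`s compatible (`exists_right`). By (F2), `v ∘ ω` is a
pasting of `γ` with cells depending only on `S`, so compatibility passes to `v ∘ ω`, then to `ω`;
(F3) carries it from `ω` to `ρ` in the same way. The data built from any choices satisfy (F1)–(F3),
so independence of the choices follows. -/

namespace BicatFractions

/-! ### Cancellation along `W` and compatible 2-morphisms -/

section Compatibility

variable {B : Type u} [Bicategory.{w, v} B] {W : MorphismProperty B}

/-- A 2-morphism is determined, up to restriction along `W`, by its whiskering with a morphism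
of `W`. -/
theorem IsBicalculus.exists_whiskerLeft_eq (hW : IsBicalculus W) {a b c : B} {w : b ⟶ a}
    (hw : W w) {f g : c ⟶ b} (β β' : f ⟶ g) (h : β ▷ w = β' ▷ w) :
    ∃ (e : B) (r : e ⟶ c), W r ∧ r ◁ β = r ◁ β' := by
  -- By `h`, both `β` and `β'` are lifts of the same cell `β ▷ w`, with identity restriction.
  let L : Lift W w f g (β ▷ w) := ⟨c, 𝟙 c, hW.id_mem c, 𝟙 c ◁ β, by bicategory⟩
  let L' : Lift W w f g (β ▷ w) := ⟨c, 𝟙 c, hW.id_mem c, 𝟙 c ◁ β', by rw [h]; bicategory⟩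
  obtain ⟨e, s, s', ζ, hs, hζ⟩ := hW.lift_unique w f g (β ▷ w) hw L L'
  change s ≫ 𝟙 c ≅ s' ≫ 𝟙 c at ζ
  change ζ.hom ▷ f ⊗≫ s' ◁ 𝟙 c ◁ β' ⊗≫ 𝟙 ((s' ≫ 𝟙 c) ≫ g) =
    𝟙 ((s ≫ 𝟙 c) ≫ f) ⊗≫ s ◁ 𝟙 c ◁ β ⊗≫ ζ.hom ▷ g at hζ
  refine ⟨e, s ≫ 𝟙 c, hs, ?_⟩
  -- As `ζ` is invertible, it can be cancelled once the interchange law has moved it to the same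
  -- side of both cells.
  rw [← cancel_mono (ζ.hom ▷ g), whisker_exchange _ β']
  calc (s ≫ 𝟙 c) ◁ β ≫ ζ.hom ▷ g
      = 𝟙 ((s ≫ 𝟙 c) ≫ f) ⊗≫ s ◁ 𝟙 c ◁ β ⊗≫ ζ.hom ▷ g := by bicategory
    _ = ζ.hom ▷ f ⊗≫ s' ◁ 𝟙 c ◁ β' ⊗≫ 𝟙 ((s' ≫ 𝟙 c) ≫ g) := hζ.symm
    _ = ζ.hom ▷ f ≫ (s' ≫ 𝟙 c) ◁ β' := by bicategory

/-- An invertible 2-morphism `w ∘ f ⇒ w ∘ g` with `w` in `W` lifts to an invertible 2-morphism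
after restriction along `W`. -/
theorem IsBicalculus.exists_iso_lift (hW : IsBicalculus W) {a b c : B} {w : b ⟶ a}
    (hw : W w) {f g : c ⟶ b} (α : f ≫ w ≅ g ≫ w) :
    ∃ (e : B) (r : e ⟶ c) (β : r ≫ f ≅ r ≫ g), W r ∧
      β.hom ▷ w = 𝟙 _ ⊗≫ r ◁ α.hom ⊗≫ 𝟙 _ := by
  obtain ⟨L, hL⟩ := hW.lift w f g α.hom hw
  have := hL inferInstance
  exact ⟨L.obj, L.arr, asIso L.cell, L.mem, L.comm⟩

/-- The restriction of an isomorphism between composites. -/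
abbrev restrictIso {x s t e e' : B} (k : e' ⟶ e) {z : e ⟶ s} {z' : e ⟶ t} {l : s ⟶ x}
    {l' : t ⟶ x} (σ : z ≫ l ≅ z' ≫ l') : (k ≫ z) ≫ l ≅ (k ≫ z') ≫ l' :=
  α_ k z l ≪≫ whiskerLeftIso k σ ≪≫ (α_ k z' l').symm

variable {x y s t e c : B} {l' : t ⟶ x} {r' : t ⟶ y} {l : s ⟶ x} {r : s ⟶ y}

/-- The restrictions of `κ` and `κ'` to `e` agree up to the identifications `σ₁` and `σ₂`. -/
def Compatible (z : e ⟶ s) (z' : e ⟶ t) (σ₁ : z' ≫ l' ≅ z ≫ l) (σ₂ : z ≫ r ≅ z' ≫ r')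
    {p : x ⟶ c} {q : y ⟶ c} (κ : l ≫ p ⟶ r ≫ q) (κ' : l' ≫ p ⟶ r' ≫ q) : Prop :=
  𝟙 (z' ≫ l' ≫ p) ⊗≫ σ₁.hom ▷ p ⊗≫ z ◁ κ ⊗≫ σ₂.hom ▷ q ⊗≫ 𝟙 (z' ≫ r' ≫ q) = z' ◁ κ'

namespace Compatible

variable {z : e ⟶ s} {z' : e ⟶ t} {σ₁ : z' ≫ l' ≅ z ≫ l} {σ₂ : z ≫ r ≅ z' ≫ r'}
  {p : x ⟶ c} {q : y ⟶ c}

theorem restrict {κ : l ≫ p ⟶ r ≫ q} {κ' : l' ≫ p ⟶ r' ≫ q}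
    (h : Compatible z z' σ₁ σ₂ κ κ') {e' : B} (k : e' ⟶ e) :
    Compatible (k ≫ z) (k ≫ z') (restrictIso k σ₁) (restrictIso k σ₂) κ κ' := by
  unfold Compatible at h ⊢
  calc _ = 𝟙 _ ⊗≫ k ◁ (𝟙 (z' ≫ l' ≫ p) ⊗≫ σ₁.hom ▷ p ⊗≫ z ◁ κ ⊗≫ σ₂.hom ▷ q ⊗≫
          𝟙 (z' ≫ r' ≫ q)) ⊗≫ 𝟙 _ := by
        simp only [restrictIso, Iso.trans_hom, whiskerLeftIso_hom, Iso.symm_hom]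
        bicategory
    _ = _ := by
        rw [h]
        bicategory

/-- Compatibility is stable under pasting with fixed 2-morphisms on both sides. -/
theorem paste {κ : l ≫ p ⟶ r ≫ q} {κ' : l' ≫ p ⟶ r' ≫ q}
    (h : Compatible z z' σ₁ σ₂ κ κ') {d : B} {f : c ⟶ d} {p₂ : x ⟶ d} {q₂ : y ⟶ d}
    (φ : p₂ ⟶ p ≫ f) (ψ : q ≫ f ⟶ q₂) :
    Compatible z z' σ₁ σ₂ (l ◁ φ ⊗≫ κ ▷ f ⊗≫ r ◁ ψ) (l' ◁ φ ⊗≫ κ' ▷ f ⊗≫ r' ◁ ψ) := by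
  unfold Compatible at h ⊢
  calc _ = 𝟙 _ ⊗≫ (σ₁.hom ▷ p₂ ≫ (z ≫ l) ◁ φ) ⊗≫ z ◁ κ ▷ f ⊗≫
          ((z ≫ r) ◁ ψ ≫ σ₂.hom ▷ q₂) ⊗≫ 𝟙 _ := by bicategory
    _ = 𝟙 _ ⊗≫ z' ◁ l' ◁ φ ⊗≫ (𝟙 (z' ≫ l' ≫ p) ⊗≫ σ₁.hom ▷ p ⊗≫ z ◁ κ ⊗≫ σ₂.hom ▷ q ⊗≫
          𝟙 (z' ≫ r' ≫ q)) ▷ f ⊗≫ z' ◁ r' ◁ ψ ⊗≫ 𝟙 _ := by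
        -- By interchange, `φ` and `ψ` slide past `σ₁` and `σ₂` to the outside, leaving the pasting
        -- in `h`.
        rw [← whisker_exchange σ₁.hom φ, whisker_exchange σ₂.hom ψ]
        bicategory
    _ = _ := by
        rw [h]
        bicategory

/-- Compatibility can be checked after whiskering with a morphism of `W`, at the cost of a
restriction along `W`. -/
theorem exists_of_whiskerRight (hW : IsBicalculus W) {κ : l ≫ p ⟶ r ≫ q}
    {κ' : l' ≫ p ⟶ r' ≫ q} {d : B} {m : c ⟶ d} (hm : W m)
    (h : Compatible z z' σ₁ σ₂ ((α_ _ _ _).inv ≫ κ ▷ m ≫ (α_ _ _ _).hom)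
      ((α_ _ _ _).inv ≫ κ' ▷ m ≫ (α_ _ _ _).hom)) :
    ∃ (e' : B) (k : e' ⟶ e), W k ∧
      Compatible (k ≫ z) (k ≫ z') (restrictIso k σ₁) (restrictIso k σ₂) κ κ' := by
  unfold Compatible at h ⊢
  obtain ⟨e', k, hk, hk'⟩ := hW.exists_whiskerLeft_eq hm
    (𝟙 (z' ≫ l' ≫ p) ⊗≫ σ₁.hom ▷ p ⊗≫ z ◁ κ ⊗≫ σ₂.hom ▷ q ⊗≫ 𝟙 (z' ≫ r' ≫ q)) (z' ◁ κ') (by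
      calc _ = 𝟙 _ ⊗≫ (𝟙 (z' ≫ l' ≫ p ≫ m) ⊗≫ σ₁.hom ▷ (p ≫ m) ⊗≫
              z ◁ ((α_ _ _ _).inv ≫ κ ▷ m ≫ (α_ _ _ _).hom) ⊗≫ σ₂.hom ▷ (q ≫ m) ⊗≫
              𝟙 (z' ≫ r' ≫ q ≫ m)) ⊗≫ 𝟙 _ := by bicategory
        _ = _ := by
          rw [h]
          bicategory)
  refine ⟨e', k, hk, ?_⟩
  calc _ = 𝟙 _ ⊗≫ k ◁ (𝟙 (z' ≫ l' ≫ p) ⊗≫ σ₁.hom ▷ p ⊗≫ z ◁ κ ⊗≫ σ₂.hom ▷ q ⊗≫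
          𝟙 (z' ≫ r' ≫ q)) ⊗≫ 𝟙 _ := by
        simp only [restrictIso, Iso.trans_hom, whiskerLeftIso_hom, Iso.symm_hom]
        bicategory
    _ = _ := by
        rw [hk']
        bicategory

/-- For invertible `κ` and `κ'` whose target ends in a morphism of `W`, an identification `σ₁` of
the left legs can be completed, after restriction along `W`. -/
theorem exists_right (hW : IsBicalculus W) (hq : W q) (κ : l ≫ p ≅ r ≫ q)
    (κ' : l' ≫ p ≅ r' ≫ q) (σ₁ : z' ≫ l' ≅ z ≫ l) :
    ∃ (e' : B) (k : e' ⟶ e) (σ₂ : (k ≫ z) ≫ r ≅ (k ≫ z') ≫ r'), W k ∧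
      Compatible (k ≫ z) (k ≫ z') (restrictIso k σ₁) σ₂ κ.hom κ'.hom := by
  -- Solving the compatibility equation for `σ₂ ▷ q` gives `κ⁻¹`, then `σ₁⁻¹`, then `κ'`; this
  -- composite is what gets lifted along `q`.
  obtain ⟨e', k, β, hk, hβ⟩ := hW.exists_iso_lift hq
    (α_ z r q ≪≫ whiskerLeftIso z κ.symm ≪≫ (α_ z l p).symm ≪≫ whiskerRightIso σ₁.symm p ≪≫
      α_ z' l' p ≪≫ whiskerLeftIso z' κ' ≪≫ (α_ z' r' q).symm)
  refine ⟨e', k, α_ k z r ≪≫ β ≪≫ (α_ k z' r').symm, hk, ?_⟩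
  unfold Compatible
  calc _ = 𝟙 _ ⊗≫ k ◁ σ₁.hom ▷ p ⊗≫ k ◁ z ◁ κ.hom ⊗≫ β.hom ▷ q ⊗≫ 𝟙 _ := by
        simp only [restrictIso, Iso.trans_hom, whiskerLeftIso_hom, Iso.symm_hom]
        bicategory
    _ = 𝟙 _ ⊗≫ k ◁ (σ₁.hom ▷ p ≫ (α_ _ _ _).hom ≫ z ◁ (κ.hom ≫ κ.inv) ≫ (α_ _ _ _).inv ≫
          σ₁.inv ▷ p) ⊗≫ k ◁ z' ◁ κ'.hom ⊗≫ 𝟙 _ := by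
        rw [hβ]
        simp only [Iso.trans_hom, whiskerLeftIso_hom, whiskerRightIso_hom, Iso.symm_hom]
        bicategory
    _ = _ := by
        simp only [Iso.hom_inv_id, whiskerLeft_id, Category.id_comp, Iso.hom_inv_id_assoc,
          hom_inv_whiskerRight]
        bicategory

end Compatible

end Compatibility

/-! ### Comparison of two sets of associator data -/

namespace Squares

variable {B : Type u} [Bicategory.{w, v} B] {W : MorphismProperty B} {a b c d : B}
  {F : Fraction W a b} {G : Fraction W b c} {H : Fraction W c d} {S : Squares F G H}

namespace AssociatorData

/-- (F2) in the shape used by `Compatible.paste`: the outer cells depend on `S` alone, so they are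
the same for every choice of `X`. The next three lemmas do the same for (F3) and for the two cells
of the diagram. -/
theorem whiskerRight_ω_eq (X : S.AssociatorData) :
    (α_ _ _ _).inv ≫ X.ω.hom ▷ G.den ≫ (α_ _ _ _).hom =
      X.u₄ ◁ ((α_ _ _ _).hom ≫ S.σ.fst ◁ S.δ.iso.inv ≫ (α_ _ _ _).inv) ⊗≫ X.γ.hom ▷ F.num ⊗≫
        X.u₅ ◁ (S.η.iso.hom ≫ (α_ _ _ _).inv) := by
  rw [X.ω_comm, omegaPasting]
  bicategory

theorem whiskerRight_ρ_eq (X : S.AssociatorData) :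
    (α_ _ _ _).inv ≫ X.ρ.hom ▷ H.den ≫ (α_ _ _ _).hom =
      X.u₄ ◁ (S.σ.iso.inv ≫ (α_ _ _ _).inv) ⊗≫ X.ω.hom ▷ G.num ⊗≫
        X.u₅ ◁ ((α_ _ _ _).hom ≫ S.η.snd ◁ S.ξ.iso.hom ≫ (α_ _ _ _).inv) := by
  rw [X.ρ_comm, rhoPasting]
  bicategory

theorem diagram_α_hom (hW : IsBicalculus W) (X : S.AssociatorData) :
    (X.diagram hW).α.hom = X.u₄ ◁ (α_ S.σ.fst S.δ.fst F.den).inv ⊗≫ X.γ.hom ▷ F.den ⊗≫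
      X.u₅ ◁ 𝟙 (S.η.fst ≫ F.den) := by
  simp only [diagram, bicategoricalIsoComp, Iso.trans_hom, whiskerRightIso_hom, Iso.refl_hom]
  bicategory

theorem diagram_β (hW : IsBicalculus W) (X : S.AssociatorData) :
    (X.diagram hW).β = X.u₄ ◁ 𝟙 (S.σ.snd ≫ H.num) ⊗≫ X.ρ.hom ▷ H.num ⊗≫
      X.u₅ ◁ (α_ S.η.snd S.ξ.snd H.num).hom := by
  simp only [diagram]
  bicategory

/-- Any two sets of associator data induce equivalent diagrams. -/
theorem diagram_equivalent (hW : IsBicalculus W) (X X' : S.AssociatorData) :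
    (X.diagram hW).Equivalent (X'.diagram hW) := by
  -- The two apexes are joined by a square over `A`. Its cell, lifted along `u ∘ u¹ ∘ u²`,
  -- identifies the left legs.
  obtain ⟨Q⟩ := hW.filler (X.u₄ ≫ S.σ.fst ≫ S.δ.fst ≫ F.den)
    (X'.u₄ ≫ S.σ.fst ≫ S.δ.fst ≫ F.den) X'.mem
  obtain ⟨e₁, k₁, σ₁, hk₁, -⟩ := hW.exists_iso_lift
    (hW.comp_mem _ _ S.σ.mem (hW.comp_mem _ _ S.δ.mem F.mem))
    (α_ Q.snd X'.u₄ (S.σ.fst ≫ S.δ.fst ≫ F.den) ≪≫ Q.iso.symm ≪≫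
      (α_ Q.fst X.u₄ (S.σ.fst ≫ S.δ.fst ≫ F.den)).symm)
  obtain ⟨e₂, k₂, σ₂, hk₂, hγ⟩ := Compatible.exists_right hW S.η.mem X.γ X'.γ
    (z := k₁ ≫ Q.fst) (z' := k₁ ≫ Q.snd) (α_ _ _ _ ≪≫ σ₁ ≪≫ (α_ _ _ _).symm)
  have hω := hγ.paste ((α_ _ _ _).hom ≫ S.σ.fst ◁ S.δ.iso.inv ≫ (α_ _ _ _).inv)
    (S.η.iso.hom ≫ (α_ _ _ _).inv)
  rw [← X.whiskerRight_ω_eq, ← X'.whiskerRight_ω_eq] at hω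
  obtain ⟨e₃, k₃, hk₃, hω⟩ := hω.exists_of_whiskerRight hW G.mem
  have hρ := hω.paste (S.σ.iso.inv ≫ (α_ _ _ _).inv)
    ((α_ _ _ _).hom ≫ S.η.snd ◁ S.ξ.iso.hom ≫ (α_ _ _ _).inv)
  rw [← X.whiskerRight_ρ_eq, ← X'.whiskerRight_ρ_eq] at hρ
  obtain ⟨e₄, k₄, hk₄, hρ⟩ := hρ.exists_of_whiskerRight hW H.mem
  -- Cancelling `v` and `w` shrank the domain, so `γ` is restricted along `k₃` and `k₄` to share its
  -- identifications with `ρ`.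
  have hα := ((hγ.restrict k₃).restrict k₄).paste (α_ S.σ.fst S.δ.fst F.den).inv
    (𝟙 (S.η.fst ≫ F.den))
  have hβ := hρ.paste (𝟙 (S.σ.snd ≫ H.num))
    (α_ S.η.snd S.ξ.snd H.num).hom
  rw [← X.diagram_α_hom hW, ← X'.diagram_α_hom hW] at hα
  rw [← X.diagram_β hW, ← X'.diagram_β hW] at hβ
  -- All the restrictions and `Q.fst` are in `W`, so the leg to `X.apex` is in `W` too.
  exact ⟨e₄, _, _, _, _, hW.comp_mem _ _ (hW.comp_mem _ _ hk₄ (hW.comp_mem _ _ hk₃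
    (hW.comp_mem _ _ hk₂ (hW.comp_mem _ _ hk₁ Q.mem)))) X.mem, hα, hβ⟩

end AssociatorData

end Squares

end BicatFractions

open BicatFractions in
theorem mainTheorem4 {B : Type u} [Bicategory.{w, v} B] (W : MorphismProperty B)
    (hW : IsBicalculus W) (C : ChoiceC W) {a b c d : B}
    (F : Fraction W a b) (G : Fraction W b c) (H : Fraction W c d) :
    (∀ (D : ChoiceD W) (X : (Squares.ofChoice hW C F G H).AssociatorData),
      (X.diagram hW).toTwoMorphism = associator hW C D F G H) ∧
    (∀ X X' : (Squares.ofChoice hW C F G H).AssociatorData,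
      (X.diagram hW).Equivalent (X'.diagram hW)) ∧
    (∀ D D' : ChoiceD W, associator hW C D F G H = associator hW C D' F G H) ∧
    (∀ (D : ChoiceD W) (C' : ChoiceC W) (D' : ChoiceD W),
      (Squares.ofChoice hW C F G H).associator hW C' D' = associator hW C D F G H) := by
  have key (X X' : (Squares.ofChoice hW C F G H).AssociatorData) :
      (X.diagram hW).toTwoMorphism = (X'.diagram hW).toTwoMorphism :=
    Quot.sound (X.diagram_equivalent hW X')
  -- Every associator here is by definition the class of some `chosenData` over the same four
  -- squares, so `key` applies.
  exact ⟨fun _ X => key X _, fun X X' => X.diagram_equivalent hW X', fun _ _ => key _ _,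
    fun _ _ _ => key _ _⟩
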